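/- Let $q\ge 1$, $[q]=\{1,\dots,q\}$ and let $\Delta(q)$ be the set of probability measures on $[q]$. For $f:[q]^n\to[q]$ and $\mu\in\Delta(q)$ write $\mu[f=i]=\mu^{\otimes n}(\{x: f(x)=i\})$. The function $f$ is called - *fair* (neutral) if $f(\sigma(x_1),\dots,\sigma(x_n))=\sigma(f(x))$ for every permutation $\sigma$ of $[q]$ and every $x\in[q]^n$; - *monotone* if, whenever $f(x)=a$ and $y$ is obtained from $x$ by changing some coordinates to $a$, also $f(y)=a$; - *symmetric* if there is a transitive group $\Sigma$ of permutations of $\{1,\dots,n\}$ with $f(x_{\sigma(1)},\dots,x_{\sigma(n)})=f(x)$ for all $\sigma\in\Sigma$ and $x\in[q]^n$. **Theorem (generalized Condorcet jury theorem).** For every $q$ there is a constant $C=C(q)>0$ such that the following holds for all $n\ge 2$, $0<\varepsilon<1/3$, $\mu\in\Delta(q)$ and $i\in[q]$. (1) If $n\ge e^{1/\varepsilon}$ and, for every $j\ne i$, $$\mu(i)>\mu(j)+C\,\bigl(\log(1-\varepsilon)-\log(1/q)\bigr)\,\frac{\log\log n}{\log n},$$ then $\mu[f=i]\ge 1-\varepsilon$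 for every fair, monotone and symmetric $f:[q]^n\to[q]$. (2) Without any lower bound on $n$ in terms of $\varepsilon$: if, for every $j\ne i$, $$\mu(i)>\mu(j)+C\,\bigl(\log(1-\varepsilon)-\log\varepsilon\bigr)\,\frac{\log\log n}{\log n},$$ then $\mu[f=i]\ge 1-\varepsilon$ for every fair, monotone and symmetric $f:[q]^n\to[q]$. -/

import Mathlib

/-- The relation `x ≤ₐ y` on `αⁿ`: the coordinates at which `x` takes the value `a` are among those at
which `y` does, and `x` and `y` agree at every coordinate at which `y` is not `a`. -/
def LeToward {α : Type*} {n : ℕ} (a : α) (x y : Fin n → α) : Prop :=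
  {k | x k = a} ⊆ {k | y k = a} ∧ ∀ k, y k ≠ a → x k = y k

/-- `f : αⁿ → α` is monotone: if `a` is chosen at `x` and `x ≤ₐ y`, then `a` is chosen at `y`. -/
def IsMonotoneChoice {α : Type*} {n : ℕ} (f : (Fin n → α) → α) : Prop :=
  ∀ (a : α) (x y : Fin n → α), LeToward a x y → f x = a → f y = a

/-- `f : αⁿ → α` is fair (neutral): it commutes with every relabelling of the alternatives. -/
def IsFairChoice {α : Type*} {n : ℕ} (f : (Fin n → α) → α) : Prop :=
  ∀ (σ : Equiv.Perm α) (x : Fin n → α), f (fun k => σ (x k)) = σ (f x)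

/-- `f : αⁿ → α` is symmetric: it is invariant under a transitive group of permutations of the
coordinates. -/
def IsSymmetricChoice {α : Type*} {n : ℕ} (f : (Fin n → α) → α) : Prop :=
  ∃ G : Subgroup (Equiv.Perm (Fin n)), MulAction.IsPretransitive G (Fin n) ∧
    ∀ σ ∈ G, ∀ x : Fin n → α, f (fun k => x (σ k)) = f x

/-! Move the voting weights along a line from a point where `i` is still a leader to `μ`, and show
that the probability `p` of `i` winning approaches 1 exponentially fast. Let `Q` be the number of
alternatives. In the direction "point mass at `i` minus uniform", Russo's formula and monotonicity
give `p' = n J / Q`, where `J` is the influence of one voter, the same for all voters by symmetry.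
Fairness and monotonicity make a leading alternative the likeliest winner, so `p ≥ 1/Q` along the
path. What remains is the influence inequality `log n * p (1 - p) ≤ 26 n J` (`log_mul_variance_le`);
with it `(1 - p)' ≤ -c (1 - p)` for `c = log n / (26 Q²)`, so a lead `T` yields `1 - p ≤ exp (-c T)`
(`one_sub_winProb_le_exp`).

The influence inequality follows the entropy method of Falik and Samorodnitsky
(`mul_variance_le_starEnergy_add`): split the function into martingale differences, bound the
entropy of each squared difference above by a logarithmic Sobolev inequality and below by its `L²`
and `L¹` norms. Energy and influence sum the differences from the base value `i` over all `j`
without the weight of `j`. This makes the log-Sobolev constant independent of the smallest atom of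
`μ`, and it is the quantity that Russo's formula produces in the chosen direction. -/

/-- The entropy of `F` with respect to the weights `m` on a finite type. -/
noncomputable def weightedEntropy {X : Type*} [Fintype X] (m F : X → ℝ) : ℝ :=
  ∑ x, m x * (F x * Real.log (F x)) - (∑ x, m x * F x) * Real.log (∑ x, m x * F x)

/-! ### Entropy inequalities on finite weighted spaces -/

section Entropy

variable {X Y : Type*} [Fintype X] [Fintype Y]

/-- The tangent bound `log x ≤ x - 1` is used twice: at `F/c` to bound `F log F` above, at `c/M` to
bound `M log M` below, `M` being the mean. The free constant `c` is chosen in the next lemma. -/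
theorem weightedEntropy_le_of_pos {m F : X → ℝ} (hm : ∀ x, 0 ≤ m x) (hm1 : ∑ x, m x = 1)
    (hF : ∀ x, 0 ≤ F x) {c : ℝ} (hc : 0 < c) :
    weightedEntropy m F ≤ ∑ x, m x * ((F x - c) ^ 2 / c) := by
  have hpt : ∀ t : ℝ, 0 ≤ t → t * Real.log t ≤ t * Real.log c + t * (t / c - 1) := by
    intro t ht
    rcases ht.eq_or_lt with rfl | ht
    · simp
    · have h := Real.log_le_sub_one_of_pos (div_pos ht hc)
      rw [Real.log_div ht.ne' hc.ne'] at h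
      nlinarith
  set M := ∑ x, m x * F x with hM
  have hM0 : 0 ≤ M := Finset.sum_nonneg fun x _ => mul_nonneg (hm x) (hF x)
  have hlow : M * Real.log c + M - c ≤ M * Real.log M := by
    rcases hM0.eq_or_lt with h0 | h0
    · rw [← h0]; simp [hc.le]
    · have h := Real.log_le_sub_one_of_pos (div_pos hc h0)
      rw [Real.log_div hc.ne' h0.ne'] at h
      have h2 := mul_le_mul_of_nonneg_left h h0.le
      have h3 : M * (c / M - 1) = c - M := by field_simp
      linarith
  have hup : ∑ x, m x * (F x * Real.log (F x))
      ≤ ∑ x, (m x * F x * Real.log c + m x * (F x * (F x / c - 1))) := by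
    refine Finset.sum_le_sum fun x _ => ?_
    have := mul_le_mul_of_nonneg_left (hpt (F x) (hF x)) (hm x)
    linarith
  have hexp : ∑ x, m x * ((F x - c) ^ 2 / c)
      = ∑ x, m x * (F x * (F x / c - 1)) - M + c := by
    have : ∀ x, m x * ((F x - c) ^ 2 / c)
        = m x * (F x * (F x / c - 1)) - m x * F x + m x * c := by
      intro x; field_simp; ring
    simp only [this, Finset.sum_add_distrib, Finset.sum_sub_distrib, ← Finset.sum_mul, hm1, hM,
      one_mul]
  rw [Finset.sum_add_distrib, ← Finset.sum_mul, ← hM] at hup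
  unfold weightedEntropy
  rw [← hM, hexp]
  linarith

/-- One-coordinate log-Sobolev inequality. The constant is free of `m` because the oscillation of
`g` is measured by its maximum, not by a variance. -/
theorem weightedEntropy_sq_le_of_sq_sub_le {m g : X → ℝ} (hm : ∀ x, 0 ≤ m x) (hm1 : ∑ x, m x = 1)
    {b R : ℝ} (hg : ∀ x, (g x - b) ^ 2 ≤ R) :
    weightedEntropy m (fun x => g x ^ 2) ≤ 9 * R := by
  -- A positive `R'` keeps the reference constant `max (b ^ 2) R'` positive; the case `R = 0` is
  -- recovered as a limit. If `b² ≤ R'`, then `g² ≤ 4R'`; otherwise `|g - b| ≤ |b|`, so `(g + b)² ≤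
  -- 9b²`. Both cases give 9.
  have key : ∀ R' : ℝ, 0 < R' → R ≤ R' → weightedEntropy m (fun x => g x ^ 2) ≤ 9 * R' := by
    intro R' hR' hRR'
    have hc : 0 < max (b ^ 2) R' := lt_max_of_lt_right hR'
    refine (weightedEntropy_le_of_pos hm hm1 (fun x => sq_nonneg (g x)) hc).trans ?_
    calc ∑ x, m x * ((g x ^ 2 - max (b ^ 2) R') ^ 2 / max (b ^ 2) R')
        ≤ ∑ x, m x * (9 * R') := by
          refine Finset.sum_le_sum fun x _ => mul_le_mul_of_nonneg_left ?_ (hm x)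
          rw [div_le_iff₀ hc]
          have hx := (hg x).trans hRR'
          set u := g x - b with hu
          have hgx : g x = b + u := by rw [hu]; ring
          rw [hgx]
          rcases le_total (b ^ 2) R' with h | h
          · rw [max_eq_right h]
            have h1 : (b + u) ^ 2 ≤ 4 * R' := by nlinarith [sq_nonneg (b - u)]
            have h2 := sq_nonneg (b + u)
            nlinarith
          · rw [max_eq_left h]
            have h1 : ((b + u) ^ 2 - b ^ 2) ^ 2 = u ^ 2 * (2 * b + u) ^ 2 := by ring
            have h2 : (2 * b + u) ^ 2 ≤ 9 * b ^ 2 := by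
              nlinarith [sq_nonneg (b - u), sq_nonneg (b + u)]
            rw [h1]
            nlinarith [mul_le_mul hx h2 (sq_nonneg _) hR'.le]
      _ = 9 * R' := by rw [← Finset.sum_mul, hm1, one_mul]
  have hR : 0 ≤ R := by
    have hne : Nonempty X := by
      by_contra h
      rw [not_nonempty_iff] at h
      simp at hm1
    exact (sq_nonneg _).trans (hg hne.some)
  refine le_of_forall_pos_le_add fun e he => ?_
  have := key (R + e / 9) (by positivity) (by linarith [div_pos he (by norm_num : (0:ℝ) < 9)])
  linarith

/-- Subadditivity of entropy. With marginal means `A`, `B` and total mean `M`, integrate `log x ≤ x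
- 1` at `x = A B / (F M)`; the error terms cancel because `A B / M` and `F` have the same mean. -/
theorem weightedEntropy_prod_le {m : X → ℝ} {v : Y → ℝ} (hm : ∀ x, 0 ≤ m x) (hv : ∀ y, 0 ≤ v y)
    {F : X × Y → ℝ} (hF : ∀ p, 0 ≤ F p) :
    weightedEntropy (fun p : X × Y => m p.1 * v p.2) F ≤
      ∑ y, v y * weightedEntropy m (fun x => F (x, y)) +
        ∑ x, m x * weightedEntropy v (fun y => F (x, y)) := by
  set A : Y → ℝ := fun y => ∑ x, m x * F (x, y) with hA
  set B : X → ℝ := fun x => ∑ y, v y * F (x, y) with hB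
  set M : ℝ := ∑ p : X × Y, m p.1 * v p.2 * F p with hM
  have hA0 : ∀ y, 0 ≤ A y := fun y => Finset.sum_nonneg fun x _ => mul_nonneg (hm x) (hF _)
  have hB0 : ∀ x, 0 ≤ B x := fun x => Finset.sum_nonneg fun y _ => mul_nonneg (hv y) (hF _)
  have hMB : M = ∑ x, m x * B x := by
    simp only [hM, hB, Fintype.sum_prod_type, Finset.mul_sum, mul_assoc]
  have hMA : M = ∑ y, v y * A y := by
    simp only [hM, hA, Fintype.sum_prod_type_right, Finset.mul_sum]
    exact Finset.sum_congr rfl fun y _ => Finset.sum_congr rfl fun x _ => by ring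
  have hM0 : 0 ≤ M := Finset.sum_nonneg fun p _ => mul_nonneg (mul_nonneg (hm _) (hv _)) (hF p)
  -- pointwise log-sum inequality
  have hpt : ∀ p : X × Y, m p.1 * v p.2 * (F p * Real.log (A p.2) + F p * Real.log (B p.1) + F p
      - A p.2 * B p.1 / M) ≤ m p.1 * v p.2 * (F p * Real.log (F p) + F p * Real.log M) := by
    rintro ⟨x, y⟩
    rcases (mul_nonneg (hm x) (hv y)).eq_or_lt with h0 | h0
    · simp only; rw [← h0]; simp
    refine mul_le_mul_of_nonneg_left ?_ h0.le
    simp only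
    rcases (hF (x, y)).eq_or_lt with hf | hf
    · rw [← hf]
      have : 0 ≤ A y * B x / M := div_nonneg (mul_nonneg (hA0 y) (hB0 x)) hM0
      simpa using this
    have hmx : 0 < m x := pos_of_mul_pos_left h0 (hv y)
    have hvy : 0 < v y := pos_of_mul_pos_right h0 (hm x)
    have hAy : 0 < A y := lt_of_lt_of_le (mul_pos hmx hf)
      (Finset.single_le_sum (f := fun x => m x * F (x, y))
        (fun x _ => mul_nonneg (hm x) (hF _)) (Finset.mem_univ x))
    have hBx : 0 < B x := lt_of_lt_of_le (mul_pos hvy hf)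
      (Finset.single_le_sum (f := fun y => v y * F (x, y))
        (fun y _ => mul_nonneg (hv y) (hF _)) (Finset.mem_univ y))
    have hMp : 0 < M := by
      rw [hMB]
      exact lt_of_lt_of_le (mul_pos hmx hBx) (Finset.single_le_sum (f := fun x => m x * B x)
        (fun x _ => mul_nonneg (hm x) (hB0 _)) (Finset.mem_univ x))
    have h := Real.log_le_sub_one_of_pos (div_pos (mul_pos hAy hBx) (mul_pos hf hMp))
    rw [Real.log_div (by positivity) (by positivity), Real.log_mul hAy.ne' hBx.ne',
      Real.log_mul hf.ne' hMp.ne'] at h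
    have h2 := mul_le_mul_of_nonneg_left h hf.le
    have h3 : F (x, y) * (A y * B x / (F (x, y) * M) - 1) = A y * B x / M - F (x, y) := by
      field_simp
    linarith
  have hsum := Finset.sum_le_sum fun p (_ : p ∈ Finset.univ) => hpt p
  have e1 : ∑ p : X × Y, m p.1 * v p.2 * (F p * Real.log (A p.2))
      = ∑ y, v y * (A y * Real.log (A y)) := by
    rw [Fintype.sum_prod_type_right]
    refine Finset.sum_congr rfl fun y _ => ?_
    rw [hA]; simp only [Finset.sum_mul, Finset.mul_sum]
    exact Finset.sum_congr rfl fun x _ => by ring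
  have e2 : ∑ p : X × Y, m p.1 * v p.2 * (F p * Real.log (B p.1))
      = ∑ x, m x * (B x * Real.log (B x)) := by
    rw [Fintype.sum_prod_type]
    refine Finset.sum_congr rfl fun x _ => ?_
    rw [hB]; simp only [Finset.sum_mul, Finset.mul_sum]
    exact Finset.sum_congr rfl fun y _ => by ring
  have e3 : ∑ p : X × Y, m p.1 * v p.2 * (A p.2 * B p.1 / M) = M := by
    rcases eq_or_ne M 0 with h | h
    · simp [h]
    · calc ∑ p : X × Y, m p.1 * v p.2 * (A p.2 * B p.1 / M)
          = (∑ x, m x * B x) * (∑ y, v y * A y) / M := by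
            rw [Fintype.sum_prod_type, Finset.sum_mul_sum, Finset.sum_div]
            refine Finset.sum_congr rfl fun x _ => ?_
            rw [Finset.sum_div]
            exact Finset.sum_congr rfl fun y _ => by ring
        _ = M := by rw [← hMB, ← hMA]; field_simp
  have e4 : ∑ p : X × Y, m p.1 * v p.2 * (F p * Real.log M) = M * Real.log M := by
    rw [hM, Finset.sum_mul]
    exact Finset.sum_congr rfl fun p _ => by ring
  have e5 : ∑ y, v y * ∑ x, m x * (F (x, y) * Real.log (F (x, y)))
      = ∑ p : X × Y, m p.1 * v p.2 * (F p * Real.log (F p)) := by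
    rw [Fintype.sum_prod_type_right]
    refine Finset.sum_congr rfl fun y _ => ?_
    rw [Finset.mul_sum]
    exact Finset.sum_congr rfl fun x _ => by ring
  have e6 : ∑ x, m x * ∑ y, v y * (F (x, y) * Real.log (F (x, y)))
      = ∑ p : X × Y, m p.1 * v p.2 * (F p * Real.log (F p)) := by
    rw [Fintype.sum_prod_type]
    refine Finset.sum_congr rfl fun x _ => ?_
    rw [Finset.mul_sum]
    exact Finset.sum_congr rfl fun y _ => by ring
  simp only [mul_add, mul_sub, Finset.sum_add_distrib, Finset.sum_sub_distrib] at hsum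
  rw [e1, e2, e3, e4] at hsum
  unfold weightedEntropy
  simp only [mul_sub, Finset.sum_sub_distrib]
  rw [e5, e6]
  simp only [hA, hB, hM] at hsum ⊢
  linarith

/-- The entropy of `d²` is at least `V log (V / b²)`, with `V` the mean of `d²` and `b` that of
`|d|`; linearizing the logarithm at a level set by `L` gives the stated form. A function with small
`L¹` norm relative to its `L²` norm thus has large entropy. -/
theorem le_weightedEntropy_sq {m d : X → ℝ} (hm : ∀ x, 0 ≤ m x) (L : ℝ) :
    L * ∑ x, m x * d x ^ 2 - Real.exp (L - 1) * (∑ x, m x * |d x|) ^ 2 ≤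
      weightedEntropy m (fun x => d x ^ 2) := by
  set V := ∑ x, m x * d x ^ 2 with hV
  set b := ∑ x, m x * |d x| with hb
  have hV0 : 0 ≤ V := Finset.sum_nonneg fun x _ => mul_nonneg (hm x) (sq_nonneg _)
  have hb0 : 0 ≤ b := Finset.sum_nonneg fun x _ => mul_nonneg (hm x) (abs_nonneg _)
  -- Here `V = 0`, and the logarithms of `V` and `b` used below would carry no information.
  by_cases hall : ∀ x, m x = 0 ∨ d x = 0
  · have hz : ∀ x, m x * d x ^ 2 = 0 := fun x => by rcases hall x with h | h <;> simp [h]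
    have hz2 : ∀ x, m x * (d x ^ 2 * Real.log (d x ^ 2)) = 0 := fun x => by
      rcases hall x with h | h <;> simp [h]
    have hV' : V = 0 := by rw [hV]; exact Finset.sum_eq_zero fun x _ => hz x
    unfold weightedEntropy
    rw [← hV, hV', Finset.sum_eq_zero fun x _ => hz2 x]
    have := mul_nonneg (Real.exp_pos (L - 1)).le (sq_nonneg b)
    simp only [mul_zero, zero_mul, sub_zero]
    linarith
  push Not at hall
  obtain ⟨x₀, hx₀, hd₀⟩ := hall
  have hmx : 0 < m x₀ := lt_of_le_of_ne (hm x₀) (Ne.symm hx₀)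
  have hVp : 0 < V := lt_of_lt_of_le (mul_pos hmx (by positivity))
    (Finset.single_le_sum (f := fun x => m x * d x ^ 2)
      (fun x _ => mul_nonneg (hm x) (sq_nonneg _)) (Finset.mem_univ x₀))
  have hbp : 0 < b := lt_of_lt_of_le (mul_pos hmx (by positivity))
    (Finset.single_le_sum (f := fun x => m x * |d x|)
      (fun x _ => mul_nonneg (hm x) (abs_nonneg _)) (Finset.mem_univ x₀))
  have hlogV : L * V - Real.exp (L - 1) * b ^ 2 ≤ V * (Real.log V - 2 * Real.log b) := by
    have h := Real.log_le_sub_one_of_pos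
      (div_pos (mul_pos (Real.exp_pos (L - 1)) (pow_pos hbp 2)) hVp)
    rw [Real.log_div (by positivity) (by positivity), Real.log_mul (by positivity) (by positivity),
      Real.log_exp, Real.log_pow] at h
    have h2 := mul_le_mul_of_nonneg_left h hVp.le
    have h3 : V * (Real.exp (L - 1) * b ^ 2 / V - 1) = Real.exp (L - 1) * b ^ 2 - V := by
      field_simp
    push_cast at h2
    linarith
  have hpt : ∀ x, m x * d x ^ 2 * (2 + 2 * Real.log V - 2 * Real.log b) - m x * |d x| * (2 * V / b)
      ≤ m x * (d x ^ 2 * Real.log (d x ^ 2)) := by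
    intro x
    rcases eq_or_ne (d x) 0 with h0 | h0
    · simp [h0]
    have hdx : 0 < |d x| := abs_pos.mpr h0
    have h := Real.log_le_sub_one_of_pos (div_pos hVp (mul_pos hdx hbp))
    rw [Real.log_div (by positivity) (by positivity), Real.log_mul (by positivity)
      (by positivity)] at h
    have hl : Real.log (d x ^ 2) = 2 * Real.log |d x| := by
      rw [← sq_abs, Real.log_pow]; norm_num
    rw [hl, ← sq_abs]
    have h2 := mul_le_mul_of_nonneg_left h
      (mul_nonneg (hm x) (mul_nonneg (by norm_num : (0:ℝ) ≤ 2) (sq_nonneg |d x|)))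
    have h3 : m x * (2 * |d x| ^ 2) * (V / (|d x| * b) - 1)
        = m x * |d x| * (2 * V / b) - 2 * (m x * |d x| ^ 2) := by
      field_simp
    linarith
  have hsum := Finset.sum_le_sum fun x (_ : x ∈ Finset.univ) => hpt x
  rw [Finset.sum_sub_distrib, ← Finset.sum_mul, ← Finset.sum_mul, ← hV, ← hb] at hsum
  have hbb : b * (2 * V / b) = 2 * V := by field_simp
  unfold weightedEntropy
  rw [← hV]
  linarith

end Entropy

/-! ### Product spaces: tensorized log-Sobolev inequality and the variance bound -/

open Function (update)

/-- The weight of a point of `αⁿ` under the product of the weights `w`. -/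
noncomputable def prodWeight {α : Type*} (w : α → ℝ) {n : ℕ} (x : Fin n → α) : ℝ := ∏ k, w (x k)

/-- The mean of `h` with respect to the product weights on `αⁿ`. -/
noncomputable def prodMean {α : Type*} [Fintype α] (w : α → ℝ) {n : ℕ} (h : (Fin n → α) → ℝ) : ℝ :=
  ∑ x, prodWeight w x * h x

/-- The `L¹` influence of coordinate `k` on `h`, relative to the base value `i`. -/
noncomputable def starInfluence {α : Type*} [Fintype α] (w : α → ℝ) (i : α) {n : ℕ} (h : (Fin n → α) → ℝ)
    (k : Fin n) : ℝ :=
  ∑ j, prodMean w fun x => |h (update x k j) - h (update x k i)|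

/-- The Dirichlet energy of `h`, relative to the base value `i`. -/
noncomputable def starEnergy {α : Type*} [Fintype α] (w : α → ℝ) (i : α) {n : ℕ} (h : (Fin n → α) → ℝ) : ℝ :=
  ∑ k, ∑ j, prodMean w fun x => (h (update x k j) - h (update x k i)) ^ 2

section ProdMean

variable {α : Type*} {w : α → ℝ} {n : ℕ}

theorem prodWeight_nonneg (hw : ∀ a, 0 ≤ w a) (x : Fin n → α) : 0 ≤ prodWeight w x :=
  Finset.prod_nonneg fun k _ => hw (x k)

theorem prodWeight_cons (a : α) (y : Fin n → α) :
    prodWeight w (Fin.cons a y : Fin (n + 1) → α) = w a * prodWeight w y := by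
  simp [prodWeight, Fin.prod_univ_succ]

variable [Fintype α]

theorem sum_cons (h : (Fin (n + 1) → α) → ℝ) :
    ∑ x, h x = ∑ p : α × (Fin n → α), h (Fin.cons p.1 p.2) :=
  (Equiv.sum_comp (Fin.consEquiv fun _ : Fin (n + 1) => α) h).symm

theorem prodMean_succ (h : (Fin (n + 1) → α) → ℝ) :
    prodMean w h = ∑ a, w a * prodMean w fun y => h (Fin.cons a y) := by
  simp only [prodMean, sum_cons, Fintype.sum_prod_type, prodWeight_cons, Finset.mul_sum, mul_assoc]

theorem prodMean_sum {ι : Type*} (s : Finset ι) (h : ι → (Fin n → α) → ℝ) :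
    prodMean w (fun x => ∑ j ∈ s, h j x) = ∑ j ∈ s, prodMean w (h j) := by
  simp only [prodMean, Finset.mul_sum]
  exact Finset.sum_comm

theorem prodMean_const_mul (c : ℝ) (h : (Fin n → α) → ℝ) :
    prodMean w (fun x => c * h x) = c * prodMean w h := by
  simp only [prodMean, Finset.mul_sum]
  exact Finset.sum_congr rfl fun x _ => by ring

theorem prodMean_add (h g : (Fin n → α) → ℝ) :
    prodMean w (fun x => h x + g x) = prodMean w h + prodMean w g := by
  simp only [prodMean, mul_add, Finset.sum_add_distrib]

theorem prodMean_sub (h g : (Fin n → α) → ℝ) :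
    prodMean w (fun x => h x - g x) = prodMean w h - prodMean w g := by
  simp only [prodMean, mul_sub, Finset.sum_sub_distrib]

theorem prodMean_mono (hw : ∀ a, 0 ≤ w a) {h g : (Fin n → α) → ℝ} (hg : ∀ x, h x ≤ g x) :
    prodMean w h ≤ prodMean w g :=
  Finset.sum_le_sum fun x _ => mul_le_mul_of_nonneg_left (hg x) (prodWeight_nonneg hw x)

theorem prodMean_nonneg (hw : ∀ a, 0 ≤ w a) {h : (Fin n → α) → ℝ} (hg : ∀ x, 0 ≤ h x) :
    0 ≤ prodMean w h :=
  Finset.sum_nonneg fun x _ => mul_nonneg (prodWeight_nonneg hw x) (hg x)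

theorem sum_prodWeight (hw1 : ∑ a, w a = 1) : ∑ x : Fin n → α, prodWeight w x = 1 := by
  induction n with
  | zero => simp [prodWeight]
  | succ n ih =>
    simp only [sum_cons, Fintype.sum_prod_type, prodWeight_cons, ← Finset.mul_sum, ih, mul_one, hw1]

theorem prodMean_const (hw1 : ∑ a, w a = 1) (c : ℝ) : prodMean w (fun _ : Fin n → α => c) = c := by
  simp only [prodMean, ← Finset.sum_mul, sum_prodWeight hw1, one_mul]

theorem prodMean_succ' (h : (Fin (n + 1) → α) → ℝ) :
    prodMean w h = prodMean w fun y => ∑ a, w a * h (Fin.cons a y) := by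
  simp only [prodMean_succ, prodMean_sum, prodMean_const_mul]

theorem starInfluence_zero (hw1 : ∑ a, w a = 1) (i : α) (h : (Fin (n + 1) → α) → ℝ) :
    starInfluence w i h 0 =
      ∑ j, prodMean w fun y => |h (Fin.cons j y) - h (Fin.cons i y)| := by
  simp only [starInfluence, prodMean_succ', Fin.update_cons_zero, ← Finset.sum_mul, hw1, one_mul]

theorem starEnergy_succ (hw1 : ∑ a, w a = 1) (i : α) (h : (Fin (n + 1) → α) → ℝ) :
    starEnergy w i h =
      (∑ j, prodMean w fun y => (h (Fin.cons j y) - h (Fin.cons i y)) ^ 2) +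
        ∑ a, w a * starEnergy w i fun y => h (Fin.cons a y) := by
  unfold starEnergy
  rw [Fin.sum_univ_succ]
  congr 1
  · simp only [prodMean_succ', Fin.update_cons_zero, ← Finset.sum_mul, hw1, one_mul]
  · simp only [prodMean_succ, Fin.cons_update, Finset.mul_sum]
    conv_rhs => rw [Finset.sum_comm]
    exact Finset.sum_congr rfl fun k _ => Finset.sum_comm

/-- Log-Sobolev inequality on the product: subadditivity peels off one coordinate, to which the
one-coordinate bound applies with base point `b = g (Fin.cons i y)`. -/
theorem weightedEntropy_sq_le_starEnergy (hw : ∀ a, 0 ≤ w a) (hw1 : ∑ a, w a = 1) (i : α)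
    (g : (Fin n → α) → ℝ) :
    weightedEntropy (prodWeight w) (fun x => g x ^ 2) ≤ 9 * starEnergy w i g := by
  induction n with
  | zero => simp [weightedEntropy, starEnergy, prodWeight]
  | succ n ih =>
    have hp := weightedEntropy_prod_le hw (prodWeight_nonneg (n := n) hw)
      (F := fun p : α × (Fin n → α) => g (Fin.cons p.1 p.2) ^ 2) fun p => sq_nonneg _
    have h0 : weightedEntropy (prodWeight w) (fun x => g x ^ 2) =
        weightedEntropy (fun p : α × (Fin n → α) => w p.1 * prodWeight w p.2)
          (fun p : α × (Fin n → α) => g (Fin.cons p.1 p.2) ^ 2) := by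
      simp only [weightedEntropy, sum_cons, prodWeight_cons]
    rw [h0, starEnergy_succ hw1, mul_add]
    refine hp.trans (add_le_add ?_ ?_)
    · rw [← prodMean_sum, ← prodMean_const_mul]
      refine prodMean_mono hw fun y => ?_
      refine weightedEntropy_sq_le_of_sq_sub_le (b := g (Fin.cons i y)) hw hw1 fun x => ?_
      exact Finset.single_le_sum (f := fun j => (g (Fin.cons j y) - g (Fin.cons i y)) ^ 2)
        (fun _ _ => sq_nonneg _) (Finset.mem_univ x)
    · rw [Finset.mul_sum]
      refine Finset.sum_le_sum fun a _ => ?_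
      have := mul_le_mul_of_nonneg_left (ih fun y => g (Fin.cons a y)) (hw a)
      simp only at this ⊢
      linarith

theorem sum_mul_sq_eq (hw1 : ∑ a, w a = 1) (f : α → ℝ) :
    ∑ a, w a * f a ^ 2 = (∑ a, w a * f a) ^ 2 + ∑ a, w a * (f a - ∑ b, w b * f b) ^ 2 := by
  set m := ∑ b, w b * f b with hm
  have : ∀ a, w a * (f a - m) ^ 2 = w a * f a ^ 2 - 2 * m * (w a * f a) + m ^ 2 * w a := by
    intro a; ring
  simp only [this, Finset.sum_add_distrib, Finset.sum_sub_distrib, ← Finset.mul_sum, hw1, ← hm]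
  ring

/-- The mean of `h` over the first coordinate. -/
noncomputable def headMean (w : α → ℝ) (h : (Fin (n + 1) → α) → ℝ) (y : Fin n → α) : ℝ :=
  ∑ a, w a * h (Fin.cons a y)

theorem prodMean_headMean (h : (Fin (n + 1) → α) → ℝ) :
    prodMean w (headMean w h) = prodMean w h := (prodMean_succ' h).symm

theorem prodMean_sq_succ (hw1 : ∑ a, w a = 1) (h : (Fin (n + 1) → α) → ℝ) :
    prodMean w (fun x => h x ^ 2) = prodMean w (fun y => headMean w h y ^ 2) +
      prodMean w (fun x => (h x - headMean w h (Fin.tail x)) ^ 2) := by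
  rw [prodMean_succ', prodMean_succ' fun x => (h x - headMean w h (Fin.tail x)) ^ 2, ← prodMean_add]
  congr 1
  ext y
  simp only [Fin.tail_cons]
  exact sum_mul_sq_eq hw1 fun a => h (Fin.cons a y)

/-- The energy is additive over the martingale decomposition. The difference in a later coordinate
is split by the law of total variance over the first one; the difference in the first coordinate
lies wholly in the second summand. -/
theorem starEnergy_eq_add (hw1 : ∑ a, w a = 1) (i : α) (h : (Fin (n + 1) → α) → ℝ) :
    starEnergy w i h = starEnergy w i (headMean w h) +
      starEnergy w i (fun x => h x - headMean w h (Fin.tail x)) := by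
  rw [starEnergy_succ hw1, starEnergy_succ hw1]
  simp only [Fin.tail_cons, sub_sub_sub_cancel_right]
  have key : ∑ a, w a * starEnergy w i (fun y => h (Fin.cons a y)) =
      starEnergy w i (headMean w h) +
        ∑ a, w a * starEnergy w i (fun y => h (Fin.cons a y) - headMean w h y) := by
    simp only [starEnergy, ← prodMean_sum, ← prodMean_const_mul]
    rw [← prodMean_add]
    congr 1
    ext y
    simp only [Finset.mul_sum]
    conv_lhs => rw [Finset.sum_comm]
    conv_rhs => arg 2; rw [Finset.sum_comm]
    rw [← Finset.sum_add_distrib]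
    refine Finset.sum_congr rfl fun k _ => ?_
    conv_lhs => rw [Finset.sum_comm]
    conv_rhs => arg 2; rw [Finset.sum_comm]
    rw [← Finset.sum_add_distrib]
    refine Finset.sum_congr rfl fun j _ => ?_
    have := sum_mul_sq_eq hw1 fun a => h (Fin.cons a (update y k j)) - h (Fin.cons a (update y k i))
    have e : headMean w h (update y k j) - headMean w h (update y k i) =
        ∑ a, w a * (h (Fin.cons a (update y k j)) - h (Fin.cons a (update y k i))) := by
      simp only [headMean, mul_sub, Finset.sum_sub_distrib]
    rw [← e] at this
    rw [this]
    congr 1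
    exact Finset.sum_congr rfl fun a _ => by ring
  rw [key]
  ring

theorem starInfluence_nonneg (hw : ∀ a, 0 ≤ w a) (i : α) (h : (Fin n → α) → ℝ) (k : Fin n) :
    0 ≤ starInfluence w i h k :=
  Finset.sum_nonneg fun _ _ => prodMean_nonneg hw fun _ => abs_nonneg _

theorem starInfluence_headMean_le (hw : ∀ a, 0 ≤ w a) (i : α) (h : (Fin (n + 1) → α) → ℝ)
    (k : Fin n) : starInfluence w i (headMean w h) k ≤ starInfluence w i h k.succ := by
  refine Finset.sum_le_sum fun j _ => ?_
  rw [prodMean_succ']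
  refine prodMean_mono hw fun y => ?_
  simp only [headMean, ← Finset.sum_sub_distrib, ← mul_sub, ← Fin.cons_update]
  refine (Finset.abs_sum_le_sum_abs _ _).trans (le_of_eq ?_)
  exact Finset.sum_congr rfl fun a _ => by rw [abs_mul, abs_of_nonneg (hw a)]

theorem prodMean_abs_sub_headMean_le (hw : ∀ a, 0 ≤ w a) (hw1 : ∑ a, w a = 1) (i : α)
    (h : (Fin (n + 1) → α) → ℝ) :
    prodMean w (fun x => |h x - headMean w h (Fin.tail x)|) ≤ 2 * starInfluence w i h 0 := by
  rw [starInfluence_zero hw1, ← prodMean_sum, ← prodMean_const_mul, prodMean_succ']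
  refine prodMean_mono hw fun y => ?_
  simp only [Fin.tail_cons]
  set f : α → ℝ := fun a => h (Fin.cons a y) with hf
  set S := ∑ j, |f j - f i| with hS
  have h1 : ∀ a, |f a - f i| ≤ S := fun a =>
    Finset.single_le_sum (f := fun j => |f j - f i|) (fun _ _ => abs_nonneg _) (Finset.mem_univ a)
  have h2 : |f i - headMean w h y| ≤ S := by
    have : f i - headMean w h y = ∑ a, w a * (f i - f a) := by
      simp only [mul_sub, Finset.sum_sub_distrib, ← Finset.sum_mul, hw1, one_mul, headMean, hf]
    rw [this]
    refine (Finset.abs_sum_le_sum_abs _ _).trans ?_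
    calc ∑ a, |w a * (f i - f a)| ≤ ∑ a, w a * S := by
          refine Finset.sum_le_sum fun a _ => ?_
          rw [abs_mul, abs_of_nonneg (hw a), abs_sub_comm]
          exact mul_le_mul_of_nonneg_left (h1 a) (hw a)
      _ = S := by rw [← Finset.sum_mul, hw1, one_mul]
  calc ∑ a, w a * |f a - headMean w h y| ≤ ∑ a, w a * (2 * S) := by
        refine Finset.sum_le_sum fun a _ => mul_le_mul_of_nonneg_left ?_ (hw a)
        have := abs_sub_le (f a) (f i) (headMean w h y)
        linarith [h1 a]
    _ = 2 * S := by rw [← Finset.sum_mul, hw1, one_mul]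

/-- An entropy form of the influence inequality on a product space with arbitrary factors. -/
theorem mul_variance_le_starEnergy_add (hw : ∀ a, 0 ≤ w a) (hw1 : ∑ a, w a = 1) (i : α) (L : ℝ)
    (h : (Fin n → α) → ℝ) :
    L * (prodMean w (fun x => h x ^ 2) - prodMean w h ^ 2) ≤
      9 * starEnergy w i h + 4 * Real.exp (L - 1) * ∑ k, starInfluence w i h k ^ 2 := by
  induction n with
  | zero => simp [prodMean, starEnergy, prodWeight]
  | succ n ih =>
    -- `h - headMean` is one martingale difference: its entropy is bounded on both sides by `h2` and
    -- `h3`, while the averaged function, on one coordinate fewer, is covered by induction.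
    -- Averaging does not increase influences.
    have h1 := ih (headMean w h)
    have h2 := le_weightedEntropy_sq (d := fun x => h x - headMean w h (Fin.tail x))
      (prodWeight_nonneg (n := n + 1) hw) L
    have h3 := weightedEntropy_sq_le_starEnergy hw hw1 i fun x => h x - headMean w h (Fin.tail x)
    have h4 := prodMean_abs_sub_headMean_le hw hw1 i h
    have h5 : prodMean w (fun x => |h x - headMean w h (Fin.tail x)|) ^ 2 ≤
        4 * starInfluence w i h 0 ^ 2 := by
      have h0 : 0 ≤ prodMean w (fun x => |h x - headMean w h (Fin.tail x)|) :=
        prodMean_nonneg hw fun _ => abs_nonneg _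
      calc _ ≤ (2 * starInfluence w i h 0) ^ 2 := pow_le_pow_left₀ h0 h4 2
        _ = _ := by ring
    have h6 : ∑ k, starInfluence w i (headMean w h) k ^ 2 ≤
        ∑ k : Fin n, starInfluence w i h k.succ ^ 2 :=
      Finset.sum_le_sum fun k _ => pow_le_pow_left₀ (starInfluence_nonneg hw i _ k)
        (starInfluence_headMean_le hw i h k) 2
    have h7 := mul_le_mul_of_nonneg_left h5 (Real.exp_pos (L - 1)).le
    have h8 := mul_le_mul_of_nonneg_left h6 (Real.exp_pos (L - 1)).le
    change L * prodMean w (fun x => (h x - headMean w h (Fin.tail x)) ^ 2) -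
      Real.exp (L - 1) * prodMean w (fun x => |h x - headMean w h (Fin.tail x)|) ^ 2 ≤ _ at h2
    rw [prodMean_sq_succ hw1, starEnergy_eq_add hw1 i h, Fin.sum_univ_succ]
    rw [prodMean_headMean] at h1
    linarith

end ProdMean

/-! ### Influences, Russo's formula and the sharp threshold -/

section Threshold

variable {α : Type*} {w : α → ℝ} {n : ℕ}

theorem indicator_update_le [DecidableEq α] {f : (Fin n → α) → α} (hf : IsMonotoneChoice f) (i j : α) (x : Fin n → α) (k : Fin n) :
    (if f (update x k j) = i then 1 else 0 : ℝ) ≤ if f (update x k i) = i then 1 else 0 := by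
  by_cases h : f (update x k j) = i
  · have : f (update x k i) = i := by
      refine hf i _ _ ⟨?_, ?_⟩ h
      · intro l hl
        rcases eq_or_ne l k with rfl | hlk
        · simp
        · simpa [hlk] using hl
      · intro l hl
        rcases eq_or_ne l k with rfl | hlk
        · simp at hl
        · simp [hlk]
    simp [h, this]
  · rw [if_neg h]
    split_ifs <;> norm_num

variable [Fintype α]

/-- For a 0/1 function energy equals total influence `n J`. If `J ≤ 1/√n`, the choice `L = log √n`
makes the quadratic term at most `4 n J`, so `L * Var ≤ 13 n J`, and `log n = 2L` gives 26. If `J ≥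
1/√n`, then `n J ≥ √n` already dominates `log n` up to a factor 2. -/
theorem log_mul_variance_le (hw : ∀ a, 0 ≤ w a) (hw1 : ∑ a, w a = 1) (hn : 0 < n) (i : α)
    {h : (Fin n → α) → ℝ} (h01 : ∀ x, h x = 0 ∨ h x = 1) {J : ℝ}
    (hJ : ∀ k, starInfluence w i h k = J) :
    Real.log n * (prodMean w h * (1 - prodMean w h)) ≤ 26 * (n * J) := by
  have hn1 : (1 : ℝ) ≤ n := by exact_mod_cast hn
  have hJ0 : 0 ≤ J := hJ ⟨0, hn⟩ ▸ starInfluence_nonneg hw i h _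
  have hE : starEnergy w i h = n * J := by
    have : starEnergy w i h = ∑ k, starInfluence w i h k := by
      refine Finset.sum_congr rfl fun k _ => Finset.sum_congr rfl fun j _ => ?_
      congr 1
      ext x
      rcases h01 (update x k j) with h1 | h1 <;> rcases h01 (update x k i) with h2 | h2 <;>
        simp [h1, h2]
    simp [this, hJ]
  have hsq : prodMean w (fun x => h x ^ 2) = prodMean w h := by
    congr 1
    ext x
    rcases h01 x with h1 | h1 <;> simp [h1]
  have hp0 : 0 ≤ prodMean w h :=
    prodMean_nonneg hw fun x => by rcases h01 x with h1 | h1 <;> simp [h1]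
  have hp1 : prodMean w h ≤ 1 := by
    rw [← prodMean_const (n := n) hw1 1]
    exact prodMean_mono hw fun x => by rcases h01 x with h1 | h1 <;> simp [h1]
  have hs : 1 ≤ √(n : ℝ) := Real.one_le_sqrt.mpr hn1
  have hss : √(n : ℝ) * √(n : ℝ) = n := Real.mul_self_sqrt (by linarith)
  have hlog : Real.log n = 2 * Real.log √(n : ℝ) := by
    rw [Real.log_sqrt (by linarith)]; ring
  have hlog0 : 0 ≤ Real.log n := Real.log_nonneg hn1
  have hV0 : 0 ≤ prodMean w h * (1 - prodMean w h) := mul_nonneg hp0 (by linarith)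
  have hV1 : prodMean w h * (1 - prodMean w h) ≤ 1 := by nlinarith
  rcases le_total (√(n : ℝ) * J) 1 with hc | hc
  · have key := mul_variance_le_starEnergy_add hw hw1 i (Real.log √(n : ℝ)) h
    have hexp : Real.exp (Real.log √(n : ℝ) - 1) ≤ √(n : ℝ) := by
      calc _ ≤ Real.exp (Real.log √(n : ℝ)) := Real.exp_le_exp.mpr (by linarith)
        _ = _ := Real.exp_log (by linarith)
    simp only [hJ, Finset.sum_const, Finset.card_univ, Fintype.card_fin, nsmul_eq_mul, hE,
      hsq] at key
    have h1 : Real.exp (Real.log √(n : ℝ) - 1) * (n * J ^ 2) ≤ n * J := by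
      calc _ ≤ √(n : ℝ) * (n * J ^ 2) :=
            mul_le_mul_of_nonneg_right hexp (by positivity)
        _ = (√(n : ℝ) * J) * (n * J) := by ring
        _ ≤ 1 * (n * J) := mul_le_mul_of_nonneg_right hc (by positivity)
        _ = _ := one_mul _
    rw [hlog]
    nlinarith
  · have h1 : Real.log √(n : ℝ) ≤ √(n : ℝ) - 1 := Real.log_le_sub_one_of_pos (by linarith)
    have h2 : √(n : ℝ) ≤ n * J := by
      calc √(n : ℝ) = √(n : ℝ) * 1 := (mul_one _).symm
        _ ≤ √(n : ℝ) * (√(n : ℝ) * J) := mul_le_mul_of_nonneg_left hc (by linarith)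
        _ = n * J := by rw [← mul_assoc, hss]
    have h3 := mul_le_mul_of_nonneg_left hV1 hlog0
    have : 0 ≤ n * J := by positivity
    linarith

/-- Russo's formula along an affine path of weights. -/
theorem hasDerivAt_prodMean {v : α → ℝ} (hw1 : ∑ a, w a = 1) (hv : ∑ a, v a = 0)
    (h : (Fin n → α) → ℝ) (t : ℝ) :
    HasDerivAt (fun s : ℝ => prodMean (fun a => w a + s * v a) h)
      (∑ k, ∑ a, v a * prodMean (fun a => w a + t * v a) fun x => h (update x k a)) t := by
  have hsum : ∑ a, (w a + t * v a) = 1 := by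
    rw [Finset.sum_add_distrib, ← Finset.mul_sum, hw1, hv, mul_zero, add_zero]
  induction n with
  | zero =>
    simp only [Finset.univ_eq_empty, Finset.sum_empty]
    have : (fun s : ℝ => prodMean (fun a => w a + s * v a) h) = fun _ => h default := by
      ext s
      simp [prodMean, prodWeight]
    rw [this]
    exact hasDerivAt_const t _
  | succ n ih =>
    have hd : HasDerivAt
        (fun s : ℝ => ∑ a, (w a + s * v a) *
          prodMean (fun a => w a + s * v a) fun y : Fin n → α => h (Fin.cons a y))
        (∑ a, ((1 * v a) * prodMean (fun a => w a + t * v a) (fun y => h (Fin.cons a y)) +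
          (w a + t * v a) * ∑ k, ∑ b, v b *
            prodMean (fun a => w a + t * v a) fun y => h (Fin.cons a (update y k b)))) t :=
      HasDerivAt.fun_sum fun a _ =>
        (((hasDerivAt_id t).mul_const (v a)).const_add (w a)).mul (ih fun y => h (Fin.cons a y))
    simp only [prodMean_succ (w := fun a => w a + _ * v a)]
    refine hd.congr_deriv ?_
    rw [Finset.sum_add_distrib, Fin.sum_univ_succ]
    congr 1
    · simp only [Fin.update_cons_zero, ← Finset.sum_mul, hsum, one_mul]
    · simp only [Fin.cons_update, Finset.mul_sum]
      rw [Finset.sum_comm]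
      refine Finset.sum_congr rfl fun k _ => ?_
      rw [Finset.sum_comm]
      exact Finset.sum_congr rfl fun b _ => Finset.sum_congr rfl fun a _ => by ring

theorem prodMean_comp_perm (σ : Equiv.Perm (Fin n)) (h : (Fin n → α) → ℝ) :
    prodMean w (fun x => h fun k => x (σ k)) = prodMean w h := by
  refine Fintype.sum_equiv (Equiv.arrowCongr σ.symm (Equiv.refl α)) _ _ fun x => ?_
  have : (Equiv.arrowCongr σ.symm (Equiv.refl α)) x = fun k => x (σ k) := by
    ext k; simp
  rw [this]
  congr 1
  exact (Equiv.prod_comp σ fun k => w (x k)).symm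

variable [DecidableEq α]

/-- The probability that `f` chooses `i` when the votes are independent with distribution `w`. -/
noncomputable def winProb (w : α → ℝ) (f : (Fin n → α) → α) (i : α) : ℝ :=
  prodMean w fun x => if f x = i then 1 else 0

variable {f : (Fin n → α) → α}

theorem winProb_swap (hf : IsFairChoice f) (i j : α) :
    winProb (fun a => w (Equiv.swap i j a)) f i = winProb w f j := by
  refine Fintype.sum_equiv (Equiv.arrowCongr (Equiv.refl (Fin n)) (Equiv.swap i j)) _ _
    fun x => ?_
  have : (Equiv.arrowCongr (Equiv.refl (Fin n)) (Equiv.swap i j)) x =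
      fun k => Equiv.swap i j (x k) := by
    ext k; simp
  beta_reduce
  rw [this, hf (Equiv.swap i j) x]
  congr 1
  have : Equiv.swap i j (f x) = j ↔ f x = i := by
    rw [Equiv.swap_apply_eq_iff, Equiv.swap_apply_right]
  simp [this]

/-- By fairness, the winning probability of `j` under `w` is that of `i` under the weights with `i`
and `j` swapped. Going back to `w` in a straight line moves mass from `j` to `i`, which by
monotonicity can only help `i`. -/
theorem winProb_le_winProb (hw : ∀ a, 0 ≤ w a) (hw1 : ∑ a, w a = 1) (hf : IsFairChoice f)
    (hm : IsMonotoneChoice f) {i j : α} (hij : w j ≤ w i) : winProb w f j ≤ winProb w f i := by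
  rcases eq_or_ne i j with rfl | hne
  · exact le_rfl
  set v : α → ℝ := fun a => (w i - w j) * ((if a = i then 1 else 0) - if a = j then 1 else 0)
    with hv
  set w' : α → ℝ := fun a => w (Equiv.swap i j a) with hw'
  have hv0 : ∑ a, v a = 0 := by
    simp [hv, ← Finset.mul_sum, Finset.sum_sub_distrib]
  have hw'1 : ∑ a, w' a = 1 := by rw [← hw1]; exact Equiv.sum_comp (Equiv.swap i j) w
  have hpos : ∀ t ∈ Set.Icc (0 : ℝ) 1, ∀ a, 0 ≤ w' a + t * v a := by
    rintro t ⟨ht0, ht1⟩ a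
    simp only [hv, hw']
    rcases eq_or_ne a i with rfl | hai
    · simp only [Equiv.swap_apply_left, if_true, if_neg hne]
      nlinarith [hw j, hw a]
    rcases eq_or_ne a j with rfl | haj
    · simp only [Equiv.swap_apply_right, if_true, if_neg hai]
      nlinarith [hw i, hw a]
    · simp [Equiv.swap_apply_of_ne_of_ne hai haj, hai, haj, hw a]
  have hder := hasDerivAt_prodMean hw'1 hv0 fun x => if f x = i then (1 : ℝ) else 0
  have hmono : MonotoneOn (fun s : ℝ => winProb (fun a => w' a + s * v a) f i) (Set.Icc 0 1) := by
    refine monotoneOn_of_hasDerivWithinAt_nonneg (convex_Icc 0 1)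
      (fun t _ => (hder t).continuousAt.continuousWithinAt)
      (fun t _ => (hder t).hasDerivWithinAt) fun t ht => ?_
    refine Finset.sum_nonneg fun k _ => ?_
    have e : ∀ A : α → ℝ, ∑ a, v a * A a = (w i - w j) * (A i - A j) := by
      intro A
      simp [hv, mul_assoc, ← Finset.mul_sum, sub_mul, Finset.sum_sub_distrib]
    rw [e]
    exact mul_nonneg (sub_nonneg.mpr hij) (sub_nonneg.mpr (prodMean_mono
      (hpos t (interior_subset ht)) fun x => indicator_update_le hm i j x k))
  have := hmono (Set.left_mem_Icc.mpr zero_le_one) (Set.right_mem_Icc.mpr zero_le_one) zero_le_one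
  simp only [zero_mul, add_zero, one_mul] at this
  have e1 : (fun a => w' a + v a) = w := by
    ext a
    simp only [hv, hw']
    rcases eq_or_ne a i with rfl | hai
    · simp only [Equiv.swap_apply_left, if_true, if_neg hne]; ring
    rcases eq_or_ne a j with rfl | haj
    · simp only [Equiv.swap_apply_right, if_true, if_neg hai]; ring
    · simp [Equiv.swap_apply_of_ne_of_ne hai haj, hai, haj]
  rw [e1] at this
  exact (winProb_swap hf i j).symm.le.trans this

theorem one_le_card_mul_winProb (hw : ∀ a, 0 ≤ w a) (hw1 : ∑ a, w a = 1) (hf : IsFairChoice f)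
    (hm : IsMonotoneChoice f) {i : α} (hi : ∀ j, w j ≤ w i) :
    1 ≤ Fintype.card α * winProb w f i := by
  have h1 : ∑ j, winProb w f j = 1 := by
    simp only [winProb, ← prodMean_sum, Finset.sum_ite_eq, Finset.mem_univ, if_true]
    exact prodMean_const hw1 1
  rw [← h1]
  calc ∑ j, winProb w f j ≤ ∑ _j : α, winProb w f i :=
        Finset.sum_le_sum fun j _ => winProb_le_winProb hw hw1 hf hm (hi j)
    _ = _ := by simp

theorem starInfluence_eq_of_symmetric (hs : IsSymmetricChoice f) (i : α) (k l : Fin n) :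
    starInfluence w i (fun x => if f x = i then 1 else 0) k =
      starInfluence w i (fun x => if f x = i then 1 else 0) l := by
  obtain ⟨G, hG, hGf⟩ := hs
  obtain ⟨⟨σ, hσ⟩, hkl⟩ := hG.exists_smul_eq k l
  have hkl : σ k = l := hkl
  subst hkl
  refine Finset.sum_congr rfl fun j _ => ?_
  rw [← prodMean_comp_perm σ]
  congr 1
  ext x
  have hu : ∀ a, f (update (fun m => x (σ m)) k a) = f (update x (σ k) a) := by
    intro a
    rw [← hGf σ hσ (update x (σ k) a)]
    congr 1
    ext m
    rcases eq_or_ne m k with rfl | hmk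
    · simp
    · simp [hmk]
  simp only [hu]

/-- The winning probability of an alternative leading by `T` is exponentially close to one. -/
theorem one_sub_winProb_le_exp [Nontrivial α] (hw : ∀ a, 0 ≤ w a) (hw1 : ∑ a, w a = 1)
    (hf : IsFairChoice f) (hm : IsMonotoneChoice f) (hs : IsSymmetricChoice f) (hn : 0 < n) {i : α}
    {T : ℝ} (hT : 0 ≤ T) (hi : ∀ j, j ≠ i → w j + T ≤ w i) :
    1 - winProb w f i ≤ Real.exp (-(Real.log n / (26 * Fintype.card α ^ 2) * T)) := by
  set Q : ℝ := (Fintype.card α : ℝ) with hQ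
  have hQ0 : 0 < Q := by rw [hQ]; exact_mod_cast Fintype.card_pos
  set h : (Fin n → α) → ℝ := fun x => if f x = i then 1 else 0 with hh
  have h01 : ∀ x, h x = 0 ∨ h x = 1 := fun x => by
    simp only [hh]; split_ifs <;> simp
  -- The path `W` ends at `w` when `t = T`. It starts at `w - T v`, where the lead of `i` has shrunk
  -- by exactly `T` and `i` is still a maximum.
  set v : α → ℝ := fun a => (if a = i then 1 else 0) - 1 / Q with hv
  set w' : α → ℝ := fun a => w a - T * v a with hw'
  have hv0 : ∑ a, v a = 0 := by
    simp [hv, Finset.sum_sub_distrib, ← hQ, hQ0.ne']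
  have hw'1 : ∑ a, w' a = 1 := by
    simp [hw', Finset.sum_sub_distrib, ← Finset.mul_sum, hv0, hw1]
  set W : ℝ → α → ℝ := fun t a => w' a + t * v a with hW
  have hW1 : ∀ t, ∑ a, W t a = 1 := by
    intro t
    simp only [hW, Finset.sum_add_distrib, ← Finset.mul_sum, hv0, hw'1, mul_zero, add_zero]
  have hWj : ∀ t a, a ≠ i → W t a = w a + (T - t) / Q := by
    intro t a ha
    simp only [hW, hw', hv, if_neg ha]; ring
  have hWi : ∀ t, W t i = w i - (T - t) + (T - t) / Q := by
    intro t
    simp only [hW, hw', hv, if_true]; ring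
  have hmax : ∀ t ∈ Set.Icc (0 : ℝ) T, ∀ j, W t j ≤ W t i := by
    rintro t ⟨ht0, -⟩ j
    rcases eq_or_ne j i with rfl | hj
    · exact le_rfl
    · rw [hWj t j hj, hWi]
      linarith [hi j hj]
  have hpos : ∀ t ∈ Set.Icc (0 : ℝ) T, ∀ a, 0 ≤ W t a := by
    intro t ht
    have hne : ∀ a, a ≠ i → 0 ≤ W t a := fun a ha => by
      rw [hWj t a ha]
      exact add_nonneg (hw a) (div_nonneg (by linarith [ht.2]) hQ0.le)
    intro a
    rcases eq_or_ne a i with rfl | ha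
    -- The weight of `i` decreases as `t` goes down; it stays nonnegative because it dominates that
    -- of another alternative.
    · obtain ⟨b, hb⟩ := exists_ne a
      exact (hne b hb).trans (hmax t ht b)
    · exact hne a ha
  set c : ℝ := Real.log n / (26 * Q ^ 2) with hc
  have hder := hasDerivAt_prodMean hw'1 hv0 h
  have hdG : ∀ t, HasDerivAt (fun s => (1 - prodMean (W s) h) * Real.exp (c * s)) _ t := fun t =>
    ((hder t).const_sub 1).mul (((hasDerivAt_id t).const_mul c).exp)
  -- Grönwall's argument with integrating factor `exp (c t)`.
  have hanti : AntitoneOn (fun s => (1 - prodMean (W s) h) * Real.exp (c * s)) (Set.Icc 0 T) := by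
    refine antitoneOn_of_hasDerivWithinAt_nonpos (convex_Icc 0 T)
      (fun t _ => (hdG t).continuousAt.continuousWithinAt)
      (fun t _ => (hdG t).hasDerivWithinAt) fun t ht => ?_
    have ht := interior_subset ht
    change -(∑ k, ∑ a, v a * prodMean (W t) fun x => h (update x k a)) * Real.exp (c * t) +
      (1 - prodMean (W t) h) * (Real.exp (c * t) * (c * 1)) ≤ 0
    set J := starInfluence (W t) i h ⟨0, hn⟩ with hJ
    have hJk : ∀ k, starInfluence (W t) i h k = J := fun k =>
      starInfluence_eq_of_symmetric hs i k _
    have hsum : (∑ k, ∑ a, v a * prodMean (W t) fun x => h (update x k a)) = n * J / Q := by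
      have : ∀ k, (∑ a, v a * prodMean (W t) fun x => h (update x k a)) = J / Q := by
        intro k
        rw [← hJk k]
        set A : α → ℝ := fun a => prodMean (W t) fun x => h (update x k a) with hA
        have e1 : starInfluence (W t) i h k = ∑ a, (A i - A a) := by
          refine Finset.sum_congr rfl fun a _ => ?_
          rw [hA]
          simp only
          rw [← prodMean_sub]
          congr 1
          ext x
          rw [abs_sub_comm, abs_of_nonneg (sub_nonneg.mpr (indicator_update_le hm i a x k))]
        have e2 : ∑ a, v a * A a = A i - (∑ a, A a) / Q := by
          simp only [hv, sub_mul, Finset.sum_sub_distrib, ite_mul, one_mul, zero_mul,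
            Finset.sum_ite_eq', Finset.mem_univ, if_true, ← Finset.mul_sum]
          ring
        rw [e1, e2, Finset.sum_sub_distrib, Finset.sum_const, Finset.card_univ, nsmul_eq_mul, ← hQ]
        field_simp
      simp only [this, Finset.sum_const, Finset.card_univ, Fintype.card_fin, nsmul_eq_mul]
      ring
    rw [hsum]
    have hkey := log_mul_variance_le (hpos t ht) (hW1 t) hn i h01 hJk
    have hstart : 1 ≤ Q * prodMean (W t) h :=
      one_le_card_mul_winProb (hpos t ht) (hW1 t) hf hm (hmax t ht)
    have hp1 : prodMean (W t) h ≤ 1 := by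
      rw [← prodMean_const (n := n) (hW1 t) 1]
      exact prodMean_mono (hpos t ht) fun x => by rcases h01 x with h1 | h1 <;> simp [h1]
    have hlog0 : 0 ≤ Real.log n := Real.log_natCast_nonneg n
    -- One factor `Q` of `c` comes from `n J / Q`, the other from replacing `p` by its lower bound
    -- `1/Q` in `p (1 - p)`.
    have hfin : (1 - prodMean (W t) h) * c ≤ n * J / Q := by
      rw [hc, mul_div_assoc', div_le_div_iff₀ (by positivity) hQ0]
      have h1 : Real.log n * (1 - prodMean (W t) h) * 1 ≤
          Real.log n * (1 - prodMean (W t) h) * (Q * prodMean (W t) h) :=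
        mul_le_mul_of_nonneg_left hstart (mul_nonneg hlog0 (by linarith))
      have h2 := mul_le_mul_of_nonneg_left hkey (sq_nonneg Q)
      have h3 := mul_le_mul_of_nonneg_left h1 hQ0.le
      linarith
    have := mul_le_mul_of_nonneg_right hfin (Real.exp_pos (c * t)).le
    linarith
  have hend := hanti (Set.left_mem_Icc.mpr hT) (Set.right_mem_Icc.mpr hT) hT
  simp only [mul_zero, Real.exp_zero, mul_one] at hend
  have hWT : W T = w := by
    ext a; simp only [hW, hw']; ring
  rw [hWT] at hend
  have h0 : 0 ≤ prodMean (W 0) h :=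
    prodMean_nonneg (hpos 0 (Set.left_mem_Icc.mpr hT)) fun x => by
      rcases h01 x with h1 | h1 <;> simp [h1]
  change 1 - prodMean w h ≤ _
  rw [Real.exp_neg, ← one_div, le_div_iff₀ (Real.exp_pos _)]
  linarith

end Threshold

/-! ### From the exponential bound to the theorem -/

theorem pi_real_eq_winProb {q n : ℕ} (μ : MeasureTheory.Measure (Fin q))
    [MeasureTheory.IsProbabilityMeasure μ] (f : (Fin n → Fin q) → Fin q) (i : Fin q) :
    (MeasureTheory.Measure.pi fun _ : Fin n => μ).real {x | f x = i} =
      winProb (fun a => μ.real {a}) f i := by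
  have h1 : {x | f x = i} = ((Finset.univ.filter fun x => f x = i : Finset (Fin n → Fin q)) :
      Set (Fin n → Fin q)) := by ext; simp
  rw [h1, ← MeasureTheory.sum_measureReal_singleton, Finset.sum_filter]
  refine Finset.sum_congr rfl fun x _ => ?_
  simp only [mul_ite, mul_one, mul_zero]
  congr 1
  simp [MeasureTheory.measureReal_def, MeasureTheory.Measure.pi_singleton, prodWeight,
    ENNReal.toReal_prod]

/-- With two voters and at least two alternatives there is no fair, monotone, symmetric rule. -/
theorem not_fair_monotone_symmetric_two {α : Type*} [Nontrivial α] (f : (Fin 2 → α) → α)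
    (hf : IsFairChoice f) (hm : IsMonotoneChoice f) (hs : IsSymmetricChoice f) : False := by
  classical
  obtain ⟨G, hG, hGf⟩ := hs
  obtain ⟨⟨σ, hσ⟩, h01⟩ := hG.exists_smul_eq 0 1
  have h01 : σ 0 = 1 := h01
  have h10 : σ 1 = 0 := by
    have : σ 1 ≠ σ 0 := fun h => by simpa using σ.injective h
    rw [h01] at this
    omega
  have key : ∀ a b : α, a ≠ b → f ![a, b] ≠ a ∧ f ![a, b] ≠ b := by
    intro a b hab
    have h1 := hGf σ hσ ![a, b]
    have h2 := hf (Equiv.swap a b) ![a, b]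
    have e : (fun k => ![a, b] (σ k)) = fun k => Equiv.swap a b (![a, b] k) := by
      ext k
      fin_cases k <;> simp [h01, h10]
    rw [e, h2] at h1
    constructor
    · intro h
      rw [h, Equiv.swap_apply_left] at h1
      exact hab h1.symm
    · intro h
      rw [h, Equiv.swap_apply_right] at h1
      exact hab h1
  obtain ⟨a, b, hab⟩ := exists_pair_ne α
  set c := f ![a, b] with hc
  obtain ⟨hca, hcb⟩ := key a b hab
  have hle : LeToward c ![a, b] ![c, b] := by
    refine ⟨fun k hk => ?_, fun k hk => ?_⟩
    · fin_cases k
      · simp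
      · simpa using hk
    · fin_cases k
      · simp at hk
      · simp
  exact (key c b hcb).1 (hm c _ _ hle rfl)

theorem one_sub_le_winProb {α : Type*} [Fintype α] [DecidableEq α] [Nontrivial α] {w : α → ℝ}
    (hw : ∀ a, 0 ≤ w a) (hw1 : ∑ a, w a = 1) {n : ℕ} {f : (Fin n → α) → α}
    (hf : IsFairChoice f) (hm : IsMonotoneChoice f) (hs : IsSymmetricChoice f) (hn : 0 < n) {i : α}
    {T ε : ℝ} (hT : 0 ≤ T) (hε : 0 < ε) (hi : ∀ j, j ≠ i → w j + T < w i)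
    (hlog : -Real.log ε ≤ Real.log n / (26 * Fintype.card α ^ 2) * T) :
    1 - ε ≤ winProb w f i := by
  have h := one_sub_winProb_le_exp hw hw1 hf hm hs hn hT fun j hj => (hi j hj).le
  have h2 := (Real.le_log_iff_exp_le hε).mp (neg_le.mp hlog)
  linarith

theorem mainTheorem4 (q : ℕ) :
    ∃ C : ℝ, 0 < C ∧
      ∀ (n : ℕ) (ε : ℝ), 2 ≤ n → 0 < ε → ε < 1 / 3 →
      ∀ (μ : MeasureTheory.Measure (Fin q)) [MeasureTheory.IsProbabilityMeasure μ] (i : Fin q),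
        ((Real.exp (1 / ε) ≤ n ∧
            ∀ j : Fin q, j ≠ i →
              μ.real {j} + C * (Real.log (1 - ε) - Real.log (1 / q)) *
                (Real.log (Real.log n) / Real.log n) < μ.real {i}) →
          ∀ f : (Fin n → Fin q) → Fin q,
            IsFairChoice f → IsMonotoneChoice f → IsSymmetricChoice f →
            1 - ε ≤ (MeasureTheory.Measure.pi fun _ : Fin n => μ).real {x | f x = i}) ∧
        ((∀ j : Fin q, j ≠ i →
              μ.real {j} + C * (Real.log (1 - ε) - Real.log ε) *
                (Real.log (Real.log n) / Real.log n) < μ.real {i}) →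
          ∀ f : (Fin n → Fin q) → Fin q,
            IsFairChoice f → IsMonotoneChoice f → IsSymmetricChoice f →
            1 - ε ≤ (MeasureTheory.Measure.pi fun _ : Fin n => μ).real {x | f x = i}) := by
  have hlog3 : 1 < Real.log 3 :=
    (Real.lt_log_iff_exp_lt (by norm_num)).mpr Real.exp_one_lt_three
  set a : ℝ := Real.log (4 / 3) with ha
  set b : ℝ := Real.log (Real.log 3) with hb
  have ha0 : 0 < a := Real.log_pos (by norm_num)
  have hb0 : 0 < b := Real.log_pos hlog3
  -- The first term serves part (1), where `a = log (4/3)` bounds the coefficient below; the second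
  -- serves part (2), where `b = log log 3` bounds `log log n` below for `n ≥ 3`. The `1` keeps `C`
  -- positive when `q = 0`.
  refine ⟨26 * q ^ 2 / a + 52 * q ^ 2 / b + 1, by positivity, ?_⟩
  set C : ℝ := 26 * q ^ 2 / a + 52 * q ^ 2 / b + 1 with hC
  intro n ε hn hε hε3 μ _ i
  have hw : ∀ j, 0 ≤ μ.real {j} := fun j => MeasureTheory.measureReal_nonneg
  have hw1 : ∑ j, μ.real {j} = 1 := by
    rw [MeasureTheory.sum_measureReal_singleton]
    simp
  rcases Nat.lt_or_ge q 2 with hq | hq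
  · have : Subsingleton (Fin q) := by
      interval_cases q
      · infer_instance
      · infer_instance
    have key : ∀ f : (Fin n → Fin q) → Fin q,
        1 - ε ≤ (MeasureTheory.Measure.pi fun _ : Fin n => μ).real {x | f x = i} := by
      intro f
      have : {x | f x = i} = Set.univ := Set.eq_univ_of_forall fun x => Subsingleton.elim _ _
      rw [this, MeasureTheory.probReal_univ]
      linarith
    exact ⟨fun _ f _ _ _ => key f, fun _ f _ _ _ => key f⟩
  have : Nontrivial (Fin q) := Fin.nontrivial_iff_two_le.mpr hq
  have hq2 : (2 : ℝ) ≤ q := by exact_mod_cast hq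
  have hcard : ((Fintype.card (Fin q) : ℕ) : ℝ) = q := by simp
  have hlogε : 0 < -Real.log ε := neg_pos.mpr (Real.log_neg hε (by linarith))
  -- the exponent supplied by a lead of the form `C * B * (log log n / log n)`
  have main : 3 ≤ n → ∀ B : ℝ, 0 ≤ B →
      26 * q ^ 2 * -Real.log ε ≤ C * (B * Real.log (Real.log n)) →
      (∀ j : Fin q, j ≠ i →
        μ.real {j} + C * B * (Real.log (Real.log n) / Real.log n) < μ.real {i}) →
      ∀ f : (Fin n → Fin q) → Fin q,
        IsFairChoice f → IsMonotoneChoice f → IsSymmetricChoice f →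
        1 - ε ≤ (MeasureTheory.Measure.pi fun _ : Fin n => μ).real {x | f x = i} := by
    intro hn3 B hB hB2 hi f hf hm hs
    have hn3' : (3 : ℝ) ≤ n := by exact_mod_cast hn3
    have hln : 1 < Real.log n := hlog3.trans_le (Real.log_le_log (by norm_num) hn3')
    have hlln : 0 < Real.log (Real.log n) := Real.log_pos hln
    rw [pi_real_eq_winProb]
    refine one_sub_le_winProb hw hw1 hf hm hs (by omega) (by positivity) hε hi ?_
    rw [hcard]
    have e : Real.log n / (26 * (q : ℝ) ^ 2) * (C * B * (Real.log (Real.log n) / Real.log n)) =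
        C * (B * Real.log (Real.log n)) / (26 * q ^ 2) := by
      have : Real.log n ≠ 0 := by linarith
      field_simp
    rw [e, le_div_iff₀ (by positivity)]
    linarith
  have hC1 : 26 * q ^ 2 ≤ C * a := by
    have h1 : C * a = 26 * q ^ 2 + (52 * q ^ 2 / b + 1) * a := by
      rw [hC]; field_simp; ring
    have h2 : 0 ≤ (52 * q ^ 2 / b + 1) * a := by positivity
    linarith
  have hC2 : 52 * q ^ 2 ≤ C * b := by
    have h1 : C * b = 52 * q ^ 2 + (26 * q ^ 2 / a + 1) * b := by
      rw [hC]; field_simp; ring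
    have h2 : 0 ≤ (26 * q ^ 2 / a + 1) * b := by positivity
    linarith
  have hC0 : 0 < C := by positivity
  constructor
  · rintro ⟨hexp, hi⟩
    have hn0 : (0 : ℝ) < n := by positivity
    have hln : 1 / ε ≤ Real.log n := (Real.le_log_iff_exp_le hn0).mpr hexp
    -- The size condition on `n` lets `log log n` supply the whole factor `log (1/ε)`; the
    -- coefficient need only be bounded below.
    have hlln : -Real.log ε ≤ Real.log (Real.log n) := by
      rw [← Real.log_inv, ← one_div]
      exact Real.log_le_log (by positivity) hln
    have hn3 : 3 ≤ n := by
      have h3 : (3 : ℝ) < 1 / ε := by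
        rw [lt_div_iff₀ hε]; linarith
      have : (3 : ℝ) < n := by linarith [Real.add_one_le_exp (1 / ε)]
      exact_mod_cast this.le
    -- `q (1 - ε) ≥ 2 · 2/3 = 4/3`.
    have hB : a ≤ Real.log (1 - ε) - Real.log (1 / q) := by
      rw [← Real.log_div (by linarith) (by positivity)]
      refine Real.log_le_log (by norm_num) ?_
      rw [div_div_eq_mul_div, div_one]
      nlinarith
    refine main hn3 _ (ha0.le.trans hB) ?_ hi
    calc 26 * (q : ℝ) ^ 2 * -Real.log ε ≤ C * a * -Real.log ε :=
          mul_le_mul_of_nonneg_right hC1 hlogε.le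
      _ = C * (a * -Real.log ε) := mul_assoc _ _ _
      _ ≤ _ := mul_le_mul_of_nonneg_left
        (mul_le_mul hB hlln hlogε.le (ha0.le.trans hB)) hC0.le
  · intro hi f hf hm hs
    -- For `n = 2`, `log log n` is negative and the hypothesis forces no lead, but no such rule
    -- exists.
    rcases hn.eq_or_lt with rfl | hn3
    · exact (not_fair_monotone_symmetric_two f hf hm hs).elim
    have hlln : b ≤ Real.log (Real.log n) := by
      refine Real.log_le_log (by linarith) (Real.log_le_log (by norm_num) ?_)
      exact_mod_cast hn3
    -- For `ε < 1/3` one has `ε ≤ (1 - ε)²`; the lost factor 2 is the reason for 52 in `C`.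
    have hB : -Real.log ε / 2 ≤ Real.log (1 - ε) - Real.log ε := by
      have h1 : Real.log ε ≤ Real.log ((1 - ε) ^ 2) := Real.log_le_log hε (by nlinarith)
      rw [Real.log_pow] at h1
      push_cast at h1
      linarith
    have hB0 : 0 ≤ Real.log (1 - ε) - Real.log ε := by linarith
    refine main hn3 _ hB0 ?_ hi f hf hm hs
    calc 26 * (q : ℝ) ^ 2 * -Real.log ε = 52 * (q : ℝ) ^ 2 * (-Real.log ε / 2) := by ring
      _ ≤ C * b * (-Real.log ε / 2) := mul_le_mul_of_nonneg_right hC2 (by linarith)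
      _ = C * (-Real.log ε / 2 * b) := by ring
      _ ≤ _ := mul_le_mul_of_nonneg_left (mul_le_mul hB hlln hb0.le hB0) hC0.le
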